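/- For finite graphs $H$ and $G$ let $\mathcal N(H,G)$ denote the number of (not necessarily induced) copies of $H$ in $G$, i.e. the number of subgraphs of $G$ isomorphic to $H$ (a subgraph being a vertex set together with an edge set, so isolated vertices of $H$ count), and let $\mathcal N(H_1,H_2;G)=\mathcal N(H_1,G)+\mathcal N(H_2,G)$. Let $\mathrm{ex}(n,(H_1,H_2),F)$ be the largest value of $\mathcal N(H_1,H_2;G)$ over all $n$-vertex graphs $G$ that contain no (not necessarily induced) subgraph isomorphic to $F$. Let $T_2(n)$ be the complete bipartite graph on $n$ vertices with parts of sizes $\lfloor n/2\rfloor$ and $\lceil n/2\rceil$. Let $M$ be the five-vertex graph consisting of two independent edges and an isolated vertex, let $M'$ be the five-vertex graph consisting of a path on three vertices and a vertex-disjoint edge, and let $C_5$ be the cycle on five vertices. Proposition. For every $n\ge 0$, the graph $T_2(n)$ is triangle-free and $$\mathrm{ex}(n,(M,C_5),K_3)=\mathcal N(M,C_5;T_2(n))\quad\text{and}\quad \mathrm{ex}(n,(M',C_5),K_3)=\mathcal N(M',C_5;T_2(n)).$$ That is, among all triangle-free graphs on $n$ vertices, $T_2(n)$ maximizes the number of copies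 of $M$ plus the number of copies of $C_5$, and also the number of copies of $M'$ plus the number of copies of $C_5$. -/

import Mathlib

/-- The graph `M` on five vertices: two independent edges `01`, `23` and the isolated vertex `4`. -/
def graphM : SimpleGraph (Fin 5) :=
  SimpleGraph.fromEdgeSet {s(0, 1), s(2, 3)}

/-- The graph `M'` on five vertices: the three-vertex path `0 - 1 - 2` and the disjoint
edge `34`. -/
def graphM' : SimpleGraph (Fin 5) :=
  SimpleGraph.fromEdgeSet {s(0, 1), s(1, 2), s(3, 4)}

/-- `N(H₁, H₂; G)`: the number of (not necessarily induced, unlabelled) copies of `H₁` in `G` plus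
the number of copies of `H₂` in `G`. A copy of `H` in `G` is a subgraph of `G` (a set of vertices
with a set of edges) isomorphic to `H`, so isolated vertices of `H` count. -/
noncomputable def pairCount {V W₁ W₂ : Type*} [Fintype V] (H₁ : SimpleGraph W₁)
    (H₂ : SimpleGraph W₂) (G : SimpleGraph V) : ℕ :=
  G.copyCount H₁ + G.copyCount H₂

open scoped Classical in
/-- `ex(n, (H₁, H₂), F)`: the largest value of `N(H₁, H₂; G)` over all `F`-free graphs `G` on `n`
vertices. -/
noncomputable def pairEx {W₁ W₂ W : Type*} (n : ℕ) (H₁ : SimpleGraph W₁) (H₂ : SimpleGraph W₂)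
    (F : SimpleGraph W) : ℕ :=
  (Finset.univ.filter fun G : SimpleGraph (Fin n) => F.Free G).sup (pairCount H₁ H₂)

/-! Let `t` be the number of edges of $T_2(n)$, `e` that of a triangle-free `G`, and `D` the sum of
its squared degrees. The number of copies of $M$ is exactly $(n-4)(e^2+e-D)/2$. Charging each
five-cycle to its edges `cd` and to the vertex opposite each of them gives $20\,\mathcal
N(C_5,G)\le(n-3)^2(ne-D)$, where $ne-D$ vanishes on complete bipartite graphs
(`labelledCopyCount_graphM_eq`, `labelledCopyCount_cycleGraph_five_le`). Both expressions decrease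
in `D`, and integrality of degrees gives $D\ge 2ne-nt$; the remaining one-variable problem in `e` is
solved by $e=t$ (`triangleFree_degree_optimization`). Hence $\mathcal N(M,G)+\mathcal
N(C_5,G)\le\mathcal N(M,T_2(n))$, which is already enough for the first pair. For $M'$, the isolated
vertex of a copy of $M$ sees at most one end of each edge in a triangle-free graph, and exactly one
in $T_2(n)$. So $\mathcal N(M',G)\le\mathcal N(M,G)$ with equality at $T_2(n)$, and the second pair
follows from the first. -/

set_option linter.unusedSectionVars false

/-! ### Labelled and unlabelled copies. -/

namespace SimpleGraph

variable {V W : Type*} {H : SimpleGraph W} {G : SimpleGraph V}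

lemma Copy.toSubgraph_adj_apply (f : H.Copy G) (i j : W) :
    f.toSubgraph.Adj (f i) (f j) ↔ H.Adj i j := by
  rw [Copy.toSubgraph, Subgraph.map_adj]
  exact Relation.map_apply_apply f.injective f.injective _ _ _

lemma Copy.toSubgraph_comp_iso (f : H.Copy G) (σ : H ≃g H) :
    (f.comp σ.toCopy).toSubgraph = f.toSubgraph := by
  have : (f.comp σ.toCopy).toHom = f.toHom.comp σ.toHom := rfl
  rw [Copy.toSubgraph, this, Subgraph.map_comp, Subgraph.map_iso_top]

/-- The automorphism is $f^{-1}\circ g$, defined because equal subgraphs have equal vertex sets. -/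
lemma Copy.exists_iso_of_toSubgraph_eq {f g : H.Copy G} (h : g.toSubgraph = f.toSubgraph) :
    ∃ σ : H ≃g H, f.comp σ.toCopy = g := by
  have hr : Set.range g = Set.range f := by
    simpa [Copy.toSubgraph, ← Set.image_univ] using congrArg Subgraph.verts h
  let σ : Equiv.Perm W := (Equiv.ofInjective g g.injective).trans
    ((Equiv.setCongr hr).trans (Equiv.ofInjective f f.injective).symm)
  have hσ (i : W) : f (σ i) = g i := Equiv.apply_ofInjective_symm f.injective _
  refine ⟨⟨σ, fun {i j} => ?_⟩, Copy.ext hσ⟩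
  rw [← f.toSubgraph_adj_apply, hσ, hσ, ← h, g.toSubgraph_adj_apply]

/-- Every unlabelled copy of `H` carries as many labellings as `H` has automorphisms. -/
lemma labelledCopyCount_eq_copyCount_mul [Fintype V] [Fintype W] (G : SimpleGraph V)
    (H : SimpleGraph W) :
    G.labelledCopyCount H = G.copyCount H * Nat.card (H ≃g H) := by
  classical
  rw [labelledCopyCount, copyCount_eq_card_image_copyToSubgraph, ← Finset.card_univ,
    Finset.card_eq_sum_card_image Copy.toSubgraph]
  refine Finset.sum_const_nat fun S hS => ?_
  obtain ⟨f, -, rfl⟩ := Finset.mem_image.1 hS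
  rw [← Fintype.card_subtype, ← Nat.card_eq_fintype_card]
  symm
  refine Nat.card_congr (Equiv.ofBijective
    (fun σ : H ≃g H => ⟨f.comp σ.toCopy, f.toSubgraph_comp_iso σ⟩) ⟨fun σ τ h => ?_, fun g => ?_⟩)
  · ext i
    exact f.injective (DFunLike.congr_fun (congrArg Subtype.val h) i)
  · obtain ⟨σ, hσ⟩ := Copy.exists_iso_of_toSubgraph_eq g.2
    exact ⟨σ, Subtype.ext hσ⟩

end SimpleGraph

/-! ### Adjacency and automorphisms of the pattern graphs. -/

lemma graphM_adj (i j : Fin 5) : graphM.Adj i j ↔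
    (i = 0 ∧ j = 1 ∨ i = 1 ∧ j = 0 ∨ i = 2 ∧ j = 3 ∨ i = 3 ∧ j = 2) := by
  unfold graphM
  revert i j
  simp only [SimpleGraph.fromEdgeSet_adj, Set.mem_insert_iff, Set.mem_singleton_iff]
  decide

lemma graphM'_adj (i j : Fin 5) : graphM'.Adj i j ↔
    (i = 0 ∧ j = 1 ∨ i = 1 ∧ j = 0 ∨ i = 1 ∧ j = 2 ∨ i = 2 ∧ j = 1 ∨
      i = 3 ∧ j = 4 ∨ i = 4 ∧ j = 3) := by
  unfold graphM'
  revert i j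
  simp only [SimpleGraph.fromEdgeSet_adj, Set.mem_insert_iff, Set.mem_singleton_iff]
  decide

lemma SimpleGraph.card_iso_self_eq {W : Type*} [Fintype W] [DecidableEq W] (H : SimpleGraph W)
    [DecidableRel H.Adj] : Nat.card (H ≃g H) =
      (Finset.univ.filter fun σ : Equiv.Perm W => ∀ i j, H.Adj (σ i) (σ j) ↔ H.Adj i j).card := by
  rw [← Fintype.card_subtype, ← Nat.card_eq_fintype_card]
  exact Nat.card_congr ⟨fun f => ⟨f.toEquiv, fun i j => f.map_rel_iff⟩,
    fun σ => ⟨σ.1, fun {i j} => σ.2 i j⟩, fun f => rfl, fun σ => rfl⟩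

set_option maxRecDepth 100000 in
lemma card_iso_graphM : Nat.card (graphM ≃g graphM) = 8 := by
  have : DecidableRel graphM.Adj := fun i j => decidable_of_iff _ (graphM_adj i j).symm
  rw [SimpleGraph.card_iso_self_eq]
  simp_rw [graphM_adj]
  decide

set_option maxRecDepth 100000 in
lemma card_iso_graphM' : Nat.card (graphM' ≃g graphM') = 4 := by
  have : DecidableRel graphM'.Adj := fun i j => decidable_of_iff _ (graphM'_adj i j).symm
  rw [SimpleGraph.card_iso_self_eq]
  simp_rw [graphM'_adj]
  decide

set_option maxRecDepth 100000 in
lemma card_iso_cycleGraph_five :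
    Nat.card (SimpleGraph.cycleGraph 5 ≃g SimpleGraph.cycleGraph 5) = 10 := by
  rw [SimpleGraph.card_iso_self_eq]
  decide

/-! ### Labelled copies as five-tuples of vertices. -/

namespace SimpleGraph

variable {V : Type*} [Fintype V] [DecidableEq V] (G : SimpleGraph V) [DecidableRel G.Adj]

lemma labelledCopyCount_fin_five (H : SimpleGraph (Fin 5)) (P : V × V × V × V × V → Prop)
    [DecidablePred P] (hP : ∀ a b c d e, P (a, b, c, d, e) ↔
      Function.Injective ![a, b, c, d, e] ∧
        ∀ i j, H.Adj i j → G.Adj (![a, b, c, d, e] i) (![a, b, c, d, e] j)) :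
    G.labelledCopyCount H = (Finset.univ.filter P).card := by
  classical
  rw [labelledCopyCount, Fintype.card_eq_nat_card, ← Fintype.card_subtype,
    Fintype.card_eq_nat_card]
  have key (f : Fin 5 → V) : ![f 0, f 1, f 2, f 3, f 4] = f := by
    ext i; fin_cases i <;> rfl
  have hf (f : H.Copy G) : P (f 0, f 1, f 2, f 3, f 4) := by
    rw [hP, key]
    exact ⟨f.injective, fun i j h => f.toHom.map_adj h⟩
  refine Nat.card_eq_of_bijective (fun f : H.Copy G =>
    (⟨(f 0, f 1, f 2, f 3, f 4), hf f⟩ : {t // P t})) ⟨fun f g h => ?_, ?_⟩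
  · have h' := congrArg Subtype.val h
    simp only [Prod.mk.injEq] at h'
    refine Copy.ext fun i => ?_
    rw [← key f, ← key g, h'.1, h'.2.1, h'.2.2.1, h'.2.2.2.1, h'.2.2.2.2]
  · rintro ⟨⟨a, b, c, d, e⟩, ht⟩
    obtain ⟨hi, ha⟩ := (hP _ _ _ _ _).1 ht
    exact ⟨⟨⟨![a, b, c, d, e], fun {i j} => ha i j⟩, hi⟩, rfl⟩

/-- The labelled copies of `graphM`, with the two edges `pq` and `xy` and the further vertex `w`. -/
def IsMatchingTuple (p q x y w : V) : Prop :=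
  G.Adj p q ∧ G.Adj x y ∧ p ≠ x ∧ p ≠ y ∧ q ≠ x ∧ q ≠ y ∧ p ≠ w ∧ q ≠ w ∧ x ≠ w ∧ y ≠ w

instance (p q x y w : V) : Decidable (G.IsMatchingTuple p q x y w) := by
  unfold IsMatchingTuple; infer_instance

/-- The labelled copies of the five-cycle. -/
def IsFiveCycleTuple (v a c d b : V) : Prop :=
  G.Adj v a ∧ G.Adj a c ∧ G.Adj c d ∧ G.Adj d b ∧ G.Adj b v ∧
    v ≠ c ∧ v ≠ d ∧ a ≠ d ∧ a ≠ b ∧ c ≠ b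

instance (v a c d b : V) : Decidable (G.IsFiveCycleTuple v a c d b) := by
  unfold IsFiveCycleTuple; infer_instance

lemma injective_vec_five {a b c d e : V} : Function.Injective ![a, b, c, d, e] ↔
    a ≠ b ∧ a ≠ c ∧ a ≠ d ∧ a ≠ e ∧ b ≠ c ∧ b ≠ d ∧ b ≠ e ∧ c ≠ d ∧ c ≠ e ∧ d ≠ e := by
  simp only [Function.Injective, Fin.forall_fin_succ, Fin.isValue]
  simp
  grind

lemma labelledCopyCount_graphM : G.labelledCopyCount graphM =
    (Finset.univ.filter fun t : V × V × V × V × V =>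
      G.IsMatchingTuple t.1 t.2.1 t.2.2.1 t.2.2.2.1 t.2.2.2.2).card := by
  refine G.labelledCopyCount_fin_five _ _ fun p q x y w => ?_
  rw [injective_vec_five]
  simp only [graphM_adj, IsMatchingTuple, or_imp, and_imp, forall_and, forall_eq_apply_imp_iff,
    forall_eq]
  simp
  grind [SimpleGraph.Adj.ne, SimpleGraph.adj_comm]

lemma labelledCopyCount_graphM' : G.labelledCopyCount graphM' =
    (Finset.univ.filter fun t : V × V × V × V × V => G.Adj t.1 t.2.1 ∧
      G.IsMatchingTuple t.2.1 t.2.2.1 t.2.2.2.1 t.2.2.2.2 t.1).card := by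
  refine G.labelledCopyCount_fin_five _ _ fun w p q x y => ?_
  rw [injective_vec_five]
  simp only [graphM'_adj, IsMatchingTuple, or_imp, and_imp, forall_and, forall_eq_apply_imp_iff,
    forall_eq]
  simp
  grind [SimpleGraph.Adj.ne, SimpleGraph.adj_comm]

lemma labelledCopyCount_cycleGraph_five : G.labelledCopyCount (cycleGraph 5) =
    (Finset.univ.filter fun t : V × V × V × V × V =>
      G.IsFiveCycleTuple t.1 t.2.1 t.2.2.1 t.2.2.2.1 t.2.2.2.2).card := by
  refine G.labelledCopyCount_fin_five _ _ fun v a c d b => ?_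
  have h : ∀ i j : Fin 5, (cycleGraph 5).Adj i j ↔ (i = 0 ∧ j = 1 ∨ i = 1 ∧ j = 0 ∨
      i = 1 ∧ j = 2 ∨ i = 2 ∧ j = 1 ∨ i = 2 ∧ j = 3 ∨ i = 3 ∧ j = 2 ∨ i = 3 ∧ j = 4 ∨
      i = 4 ∧ j = 3 ∨ i = 4 ∧ j = 0 ∨ i = 0 ∧ j = 4) := by decide
  rw [injective_vec_five]
  simp only [h, IsFiveCycleTuple, or_imp, and_imp, forall_and, forall_eq_apply_imp_iff,
    forall_eq]
  simp
  grind [SimpleGraph.Adj.ne, SimpleGraph.adj_comm]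

end SimpleGraph

/-! ### Copies of $M$ and $C_5$ in terms of degree sums. -/

namespace SimpleGraph

variable {V : Type*} [Fintype V] [DecidableEq V] (G : SimpleGraph V) [DecidableRel G.Adj]

/-- The adjacency indicator, as an integer. -/
def adjInd (u v : V) : ℤ := if G.Adj u v then 1 else 0

/-- The sum of the degrees. -/
def degSum : ℤ := ∑ v, (G.degree v : ℤ)

/-- The sum of the squares of the degrees. -/
def degSqSum : ℤ := ∑ v, (G.degree v : ℤ) ^ 2

lemma adjInd_comm (u v : V) : G.adjInd u v = G.adjInd v u := by
  simp [adjInd, G.adj_comm]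

lemma adjInd_self (u : V) : G.adjInd u u = 0 := by simp [adjInd]

lemma sum_adjInd (u : V) : ∑ v, G.adjInd u v = G.degree u := by
  simp [adjInd, Finset.sum_boole, ← G.card_neighborFinset_eq_degree, neighborFinset_eq_filter]

lemma sum_adjInd' (u : V) : ∑ v, G.adjInd v u = G.degree u := by
  simp_rw [fun v => G.adjInd_comm v u, sum_adjInd]

lemma sum_sum_adjInd : ∑ u, ∑ v, G.adjInd u v = G.degSum := by
  simp_rw [sum_adjInd, degSum]

lemma sum_sum_adjInd_mul_degree_left : ∑ u, ∑ v, G.adjInd u v * G.degree u = G.degSqSum := by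
  simp_rw [← Finset.sum_mul, sum_adjInd, degSqSum, sq]

lemma sum_sum_adjInd_mul_degree_right : ∑ u, ∑ v, G.adjInd u v * G.degree v = G.degSqSum := by
  rw [Finset.sum_comm]
  simp_rw [← Finset.sum_mul, sum_adjInd', degSqSum, sq]

lemma sum_sum_adjInd_mul_card_sub :
    ∑ c, ∑ d, (G.adjInd c d * (Fintype.card V) - G.adjInd c d * G.degree c -
      G.adjInd c d * G.degree d) = Fintype.card V * G.degSum - 2 * G.degSqSum := by
  simp_rw [Finset.sum_sub_distrib]
  rw [sum_sum_adjInd_mul_degree_left, sum_sum_adjInd_mul_degree_right]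
  simp_rw [← Finset.sum_mul, sum_sum_adjInd]
  ring

/-- Inclusion–exclusion for the ordered edges `xy` avoiding `p` and `q`: the final `2` restores `pq`
and `qp`, each subtracted twice. -/
lemma sum_adjInd_mul_sub (p q : V) (h : G.Adj p q) :
    ∑ x, ∑ y, G.adjInd x y * ((1 - (if p = x then 1 else 0) - (if q = x then 1 else 0)) *
      (1 - (if p = y then 1 else 0) - (if q = y then 1 else 0))) =
    G.degSum - 2 * G.degree p - 2 * G.degree q + 2 := by
  have h1 : G.adjInd p q = 1 := by simp [adjInd, h]
  have h2 : G.adjInd q p = 1 := by simp [adjInd, h.symm]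
  have inner (x : V) : ∑ y, G.adjInd x y *
      ((1 - (if p = x then 1 else 0) - (if q = x then 1 else 0)) *
      (1 - (if p = y then 1 else 0) - (if q = y then 1 else 0))) =
      ((G.degree x : ℤ) - G.adjInd x p - G.adjInd x q) *
      (1 - (if p = x then 1 else 0) - (if q = x then 1 else 0)) := by
    rw [← G.sum_adjInd x]
    simp only [mul_left_comm (G.adjInd x _), ← Finset.mul_sum]
    rw [mul_comm]
    congr 1
    simp [mul_sub, Finset.sum_sub_distrib]
  simp_rw [inner]
  simp only [mul_sub, Finset.sum_sub_distrib, mul_one, mul_ite, mul_zero, Finset.sum_ite_eq,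
    Finset.mem_univ, if_true, sum_adjInd', adjInd_self, h1, h2, degSum]
  ring

/-- The isolated vertex has $n-4$ choices once two disjoint ordered edges are fixed; those pairs are
counted by `sum_adjInd_mul_sub`, summed over the first edge. -/
lemma labelledCopyCount_graphM_eq : (G.labelledCopyCount graphM : ℤ) =
    ((Fintype.card V : ℤ) - 4) * (G.degSum ^ 2 + 2 * G.degSum - 4 * G.degSqSum) := by
  rw [labelledCopyCount_graphM, Finset.card_filter]
  push_cast
  simp only [Fintype.sum_prod_type]
  have hw (p q x y : V) : ∑ w, (if G.IsMatchingTuple p q x y w then (1 : ℤ) else 0) =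
      (Fintype.card V - 4) * (G.adjInd p q * (G.adjInd x y *
      ((1 - (if p = x then 1 else 0) - (if q = x then 1 else 0)) *
      (1 - (if p = y then 1 else 0) - (if q = y then 1 else 0))))) := by
    by_cases h : G.Adj p q ∧ G.Adj x y ∧ p ≠ x ∧ p ≠ y ∧ q ≠ x ∧ q ≠ y
    · obtain ⟨h1, h2, h3, h4, h5, h6⟩ := h
      have hc : (({p, q, x, y} : Finset V)ᶜ.card : ℤ) = Fintype.card V - 4 := by
        have := Finset.card_add_card_compl ({p, q, x, y} : Finset V)
        rw [Finset.card_insert_of_notMem (by simp [h1.ne, h3, h4]),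
          Finset.card_insert_of_notMem (by simp [h5, h6]), Finset.card_pair h2.ne] at this
        omega
      simp only [adjInd, h1, h2, h3, h4, h5, h6, if_true, if_false]
      rw [Finset.sum_boole, ← hc]
      simp only [sub_zero, mul_one, Nat.cast_inj]
      congr 1
      ext w
      rw [Finset.mem_filter]
      simp only [Finset.mem_univ, true_and, IsMatchingTuple, Finset.mem_compl,
        Finset.mem_insert, Finset.mem_singleton]
      grind
    · have hz (w : V) : ¬ G.IsMatchingTuple p q x y w := by unfold IsMatchingTuple; tauto
      simp only [hz, if_false, Finset.sum_const_zero]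
      by_cases h1 : G.Adj p q <;> by_cases h2 : G.Adj x y <;> simp only [adjInd, h1, h2, if_true,
        if_false, zero_mul, mul_zero, one_mul]
      have := h1.ne
      have := h2.ne
      grind
  simp_rw [hw, ← Finset.mul_sum]
  have hpq (p q : V) : G.adjInd p q * ∑ x, ∑ y, G.adjInd x y *
      ((1 - (if p = x then 1 else 0) - (if q = x then 1 else 0)) *
      (1 - (if p = y then 1 else 0) - (if q = y then 1 else 0))) =
      G.adjInd p q * (G.degSum + 2) - 2 * (G.adjInd p q * G.degree p) -
        2 * (G.adjInd p q * G.degree q) := by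
    by_cases h : G.Adj p q
    · rw [G.sum_adjInd_mul_sub p q h]; ring
    · simp [adjInd, h]
  simp_rw [hpq, Finset.sum_sub_distrib, ← Finset.mul_sum]
  rw [sum_sum_adjInd_mul_degree_left, sum_sum_adjInd_mul_degree_right]
  simp_rw [← Finset.sum_mul, sum_sum_adjInd]
  ring

variable {G}

lemma CliqueFree.not_adj (hG : G.CliqueFree 3) {a b c : V} (h1 : G.Adj a b) (h2 : G.Adj b c) :
    ¬ G.Adj a c :=
  fun h3 => hG {a, b, c} (is3Clique_triple_iff.2 ⟨h1, h3, h2⟩)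

lemma CliqueFree.adjInd_add_adjInd_le (hG : G.CliqueFree 3) {c d : V} (h : G.Adj c d) (v : V) :
    0 ≤ 1 - G.adjInd c v - G.adjInd d v := by
  unfold adjInd
  by_cases h1 : G.Adj c v <;> by_cases h2 : G.Adj d v <;> simp [h1, h2]
  exact hG.not_adj h h2 h1

lemma CliqueFree.degree_add_degree_le (hG : G.CliqueFree 3) {c d : V} (h : G.Adj c d) :
    (0 : ℤ) ≤ (Fintype.card V : ℤ) - G.degree c - G.degree d := by
  have := Finset.sum_nonneg fun v (_ : v ∈ Finset.univ) => hG.adjInd_add_adjInd_le h v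
  simp only [Finset.sum_sub_distrib, sum_adjInd] at this
  simpa using this

/-- Fix the edge `cd`. The opposite vertex `v` is adjacent to neither end, since otherwise a
triangle with `a` or `b` appears, and the neighbourhoods of `c` and `d` are disjoint. This leaves
$n-d(c)-d(d)$ choices for `v`, and at most $(d(c)-1)(d(d)-1)$ for `a` and `b`. -/
lemma labelledCopyCount_cycleGraph_five_le (hG : G.CliqueFree 3) :
    4 * (G.labelledCopyCount (cycleGraph 5) : ℤ) ≤
      ((Fintype.card V : ℤ) - 3) ^ 2 * (Fintype.card V * G.degSum - 2 * G.degSqSum) := by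
  have key (c d : V) : 4 * ∑ v, ∑ a, ∑ b,
      (if G.IsFiveCycleTuple v a c d b then (1 : ℤ) else 0) ≤
      ((Fintype.card V : ℤ) - 3) ^ 2 * (G.adjInd c d * (Fintype.card V) -
        G.adjInd c d * G.degree c - G.adjInd c d * G.degree d) := by
    by_cases h : G.Adj c d
    · have h1 : G.adjInd c d = 1 := by simp [adjInd, h]
      have hle (v a b : V) : (if G.IsFiveCycleTuple v a c d b then (1 : ℤ) else 0) ≤
          (1 - G.adjInd c v - G.adjInd d v) * ((G.adjInd c a - if d = a then 1 else 0) *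
            (G.adjInd d b - if c = b then 1 else 0)) := by
        have e1 : 0 ≤ G.adjInd c a - if d = a then 1 else 0 := by
          unfold adjInd; split_ifs <;> simp_all
        have e2 : 0 ≤ G.adjInd d b - if c = b then 1 else 0 := by
          have := h.symm
          unfold adjInd; split_ifs <;> simp_all
        by_cases hc : G.IsFiveCycleTuple v a c d b
        · rw [if_pos hc]
          obtain ⟨k1, k2, k3, k4, k5, k6, k7, k8, k9, k10⟩ := hc
          have n1 : ¬ G.Adj c v := fun k => hG.not_adj k k1 k2.symm
          have n2 : ¬ G.Adj d v := fun k => hG.not_adj k k5.symm k4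
          simp [adjInd, n1, n2, k2.symm, k4, k8.symm, k10]
        · rw [if_neg hc]
          exact mul_nonneg (hG.adjInd_add_adjInd_le h v) (mul_nonneg e1 e2)
      have hsum : ∑ v, ∑ a, ∑ b, (1 - G.adjInd c v - G.adjInd d v) *
          ((G.adjInd c a - if d = a then 1 else 0) * (G.adjInd d b - if c = b then 1 else 0)) =
          ((Fintype.card V : ℤ) - G.degree c - G.degree d) *
            (((G.degree c : ℤ) - 1) * ((G.degree d : ℤ) - 1)) := by
        simp_rw [← Finset.mul_sum, ← Finset.sum_mul]
        simp [Finset.sum_sub_distrib, sum_adjInd]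
      have hs := hG.degree_add_degree_le h
      have hc1 : 1 ≤ (G.degree c : ℤ) := by
        exact_mod_cast (G.degree_pos_iff_exists_adj c).2 ⟨d, h⟩
      have hd1 : 1 ≤ (G.degree d : ℤ) := by
        exact_mod_cast (G.degree_pos_iff_exists_adj d).2 ⟨c, h.symm⟩
      have hle' := Finset.sum_le_sum fun v (_ : v ∈ Finset.univ) => Finset.sum_le_sum
        fun a (_ : a ∈ Finset.univ) => Finset.sum_le_sum fun b (_ : b ∈ Finset.univ) => hle v a b
      rw [hsum] at hle'
      rw [h1]
      generalize (G.degree c : ℤ) = x at *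
      generalize (G.degree d : ℤ) = y at *
      generalize (Fintype.card V : ℤ) = n at *
      suffices 4 * ((n - x - y) * ((x - 1) * (y - 1))) ≤ (n - 3) ^ 2 * (n - x - y) by linarith
      -- If $x+y=n$ both sides vanish. Otherwise $x+y\le n-1$, so AM-GM yields $n-3$ instead of
      -- $n-2$.
      rcases hs.eq_or_lt with h0 | h0
      · simp [← h0]
      · have h2 : 4 * ((x - 1) * (y - 1)) ≤ (n - 3) ^ 2 := by
          have : (x + y - 2) ^ 2 ≤ (n - 3) ^ 2 := by
            apply pow_le_pow_left₀ <;> omega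
          nlinarith [sq_nonneg (x - y)]
        nlinarith
    · have hz (v a b : V) : ¬ G.IsFiveCycleTuple v a c d b := by unfold IsFiveCycleTuple; tauto
      simp [hz, adjInd, h]
  rw [labelledCopyCount_cycleGraph_five, Finset.card_filter]
  push_cast
  simp only [Fintype.sum_prod_type]
  have hswap : ∑ v, ∑ a, ∑ c, ∑ d, ∑ b,
      (if G.IsFiveCycleTuple v a c d b then (1 : ℤ) else 0) =
      ∑ c, ∑ d, ∑ v, ∑ a, ∑ b, (if G.IsFiveCycleTuple v a c d b then (1 : ℤ) else 0) := by
    simp_rw [fun v => Finset.sum_comm (s := Finset.univ) (t := Finset.univ)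
      (f := fun a c => ∑ d, ∑ b, (if G.IsFiveCycleTuple v a c d b then (1 : ℤ) else 0))]
    rw [Finset.sum_comm]
    refine Finset.sum_congr rfl fun c _ => ?_
    simp_rw [fun v => Finset.sum_comm (s := Finset.univ) (t := Finset.univ)
      (f := fun a d => ∑ b, (if G.IsFiveCycleTuple v a c d b then (1 : ℤ) else 0))]
    rw [Finset.sum_comm]
  rw [hswap]
  refine le_trans ?_ (le_of_eq ?_) (b := ∑ c, ∑ d, ((Fintype.card V : ℤ) - 3) ^ 2 *
    (G.adjInd c d * (Fintype.card V) - G.adjInd c d * G.degree c - G.adjInd c d * G.degree d))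
  · simp_rw [Finset.mul_sum] at key ⊢
    exact Finset.sum_le_sum fun c _ => Finset.sum_le_sum fun d _ => key c d
  · simp_rw [← Finset.mul_sum]
    rw [sum_sum_adjInd_mul_card_sub]

end SimpleGraph

/-! ### Comparison of $M'$ with $M$, and degree inequalities. -/

namespace SimpleGraph

variable {V : Type*} [Fintype V] [DecidableEq V] {G : SimpleGraph V} [DecidableRel G.Adj]

lemma IsMatchingTuple.swap {p q x y w : V} (h : G.IsMatchingTuple p q x y w) :
    G.IsMatchingTuple x y p q w := by
  unfold IsMatchingTuple at *
  grind

/-- The number of `p, q, x, y` adjacent to `w`, summed over the labelled copies of `graphM`. -/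
lemma sum_isMatchingTuple_adj :
    ∑ t : V × V × V × V × V with G.IsMatchingTuple t.1 t.2.1 t.2.2.1 t.2.2.2.1 t.2.2.2.2,
      ((if G.Adj t.2.2.2.2 t.1 then 1 else 0) + (if G.Adj t.2.2.2.2 t.2.1 then 1 else 0) +
        (if G.Adj t.2.2.2.2 t.2.2.1 then 1 else 0) +
        (if G.Adj t.2.2.2.2 t.2.2.2.1 then 1 else 0)) = 4 * G.labelledCopyCount graphM' := by
  simp_rw [Finset.sum_add_distrib, ← Finset.card_filter, Finset.filter_filter]
  rw [labelledCopyCount_graphM']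
  have h1 : (Finset.univ.filter fun t : V × V × V × V × V =>
      G.IsMatchingTuple t.1 t.2.1 t.2.2.1 t.2.2.2.1 t.2.2.2.2 ∧ G.Adj t.2.2.2.2 t.1).card =
      (Finset.univ.filter fun t : V × V × V × V × V => G.Adj t.1 t.2.1 ∧
      G.IsMatchingTuple t.2.1 t.2.2.1 t.2.2.2.1 t.2.2.2.2 t.1).card := by
    refine Finset.card_nbij' (fun t => (t.2.2.2.2, t.1, t.2.1, t.2.2.1, t.2.2.2.1))
      (fun t => (t.2.1, t.2.2.1, t.2.2.2.1, t.2.2.2.2, t.1)) ?_ ?_ ?_ ?_ <;>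
      simp +contextual [Set.MapsTo, Set.LeftInvOn]
  have h2 : (Finset.univ.filter fun t : V × V × V × V × V =>
      G.IsMatchingTuple t.1 t.2.1 t.2.2.1 t.2.2.2.1 t.2.2.2.2 ∧ G.Adj t.2.2.2.2 t.2.1).card =
      (Finset.univ.filter fun t : V × V × V × V × V =>
      G.IsMatchingTuple t.1 t.2.1 t.2.2.1 t.2.2.2.1 t.2.2.2.2 ∧ G.Adj t.2.2.2.2 t.1).card := by
    refine Finset.card_nbij' (fun t => (t.2.1, t.1, t.2.2.1, t.2.2.2.1, t.2.2.2.2))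
      (fun t => (t.2.1, t.1, t.2.2.1, t.2.2.2.1, t.2.2.2.2)) ?_ ?_ ?_ ?_ <;>
      simp +contextual [Set.MapsTo, Set.LeftInvOn, IsMatchingTuple, G.adj_comm]
  have h3 : (Finset.univ.filter fun t : V × V × V × V × V =>
      G.IsMatchingTuple t.1 t.2.1 t.2.2.1 t.2.2.2.1 t.2.2.2.2 ∧ G.Adj t.2.2.2.2 t.2.2.1).card =
      (Finset.univ.filter fun t : V × V × V × V × V =>
      G.IsMatchingTuple t.1 t.2.1 t.2.2.1 t.2.2.2.1 t.2.2.2.2 ∧ G.Adj t.2.2.2.2 t.1).card := by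
    refine Finset.card_nbij' (fun t => (t.2.2.1, t.2.2.2.1, t.1, t.2.1, t.2.2.2.2))
      (fun t => (t.2.2.1, t.2.2.2.1, t.1, t.2.1, t.2.2.2.2))
      (fun t ht => ?_) (fun t ht => ?_) (fun _ _ => rfl) (fun _ _ => rfl) <;>
      simp only [Finset.coe_filter, Set.mem_ofPred_eq, Finset.mem_univ, true_and] at ht ⊢ <;>
      exact ⟨ht.1.swap, ht.2⟩
  have h4 : (Finset.univ.filter fun t : V × V × V × V × V =>
      G.IsMatchingTuple t.1 t.2.1 t.2.2.1 t.2.2.2.1 t.2.2.2.2 ∧ G.Adj t.2.2.2.2 t.2.2.2.1).card =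
      (Finset.univ.filter fun t : V × V × V × V × V =>
      G.IsMatchingTuple t.1 t.2.1 t.2.2.1 t.2.2.2.1 t.2.2.2.2 ∧ G.Adj t.2.2.2.2 t.2.1).card := by
    refine Finset.card_nbij' (fun t => (t.2.2.1, t.2.2.2.1, t.1, t.2.1, t.2.2.2.2))
      (fun t => (t.2.2.1, t.2.2.2.1, t.1, t.2.1, t.2.2.2.2))
      (fun t ht => ?_) (fun t ht => ?_) (fun _ _ => rfl) (fun _ _ => rfl) <;>
      simp only [Finset.coe_filter, Set.mem_ofPred_eq, Finset.mem_univ, true_and] at ht ⊢ <;>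
      exact ⟨ht.1.swap, ht.2⟩
  omega

/-- In each labelled $M$, the vertex `w` has at most one neighbour in each of the two edges, so it
contributes at most 2 to `sum_isMatchingTuple_adj`. -/
lemma labelledCopyCount_graphM'_le (hG : G.CliqueFree 3) :
    2 * G.labelledCopyCount graphM' ≤ G.labelledCopyCount graphM := by
  suffices 4 * G.labelledCopyCount graphM' ≤ G.labelledCopyCount graphM * 2 by omega
  rw [← sum_isMatchingTuple_adj, labelledCopyCount_graphM]
  refine Finset.sum_le_card_nsmul _ _ _ fun ⟨p, q, x, y, w⟩ ht => ?_
  obtain ⟨h1, h2, -⟩ := (Finset.mem_filter.1 ht).2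
  have k1 : ¬ (G.Adj w p ∧ G.Adj w q) := fun h => hG.not_adj h.1 h1 h.2
  have k2 : ¬ (G.Adj w x ∧ G.Adj w y) := fun h => hG.not_adj h.1 h2 h.2
  dsimp only at *
  split_ifs <;> simp_all

lemma labelledCopyCount_graphM'_eq
    (hG : ∀ u v w, G.Adj u v → (G.Adj w u ↔ ¬ G.Adj w v)) :
    2 * G.labelledCopyCount graphM' = G.labelledCopyCount graphM := by
  suffices 4 * G.labelledCopyCount graphM' = G.labelledCopyCount graphM * 2 by omega
  rw [← sum_isMatchingTuple_adj, labelledCopyCount_graphM]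
  refine Finset.sum_const_nat fun ⟨p, q, x, y, w⟩ ht => ?_
  obtain ⟨h1, h2, -⟩ := (Finset.mem_filter.1 ht).2
  have k1 := hG p q w h1
  have k2 := hG x y w h2
  dsimp only at *
  split_ifs <;> simp_all

lemma labelledCopyCount_graphM_eq_mul (G : SimpleGraph V) :
    G.labelledCopyCount graphM = G.copyCount graphM * 8 := by
  rw [labelledCopyCount_eq_copyCount_mul, card_iso_graphM]

lemma labelledCopyCount_graphM'_eq_mul (G : SimpleGraph V) :
    G.labelledCopyCount graphM' = G.copyCount graphM' * 4 := by
  rw [labelledCopyCount_eq_copyCount_mul, card_iso_graphM']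

lemma labelledCopyCount_cycleGraph_five_eq_mul (G : SimpleGraph V) :
    G.labelledCopyCount (cycleGraph 5) = G.copyCount (cycleGraph 5) * 10 := by
  rw [labelledCopyCount_eq_copyCount_mul, card_iso_cycleGraph_five]

/-- The degree sequence inequality `∑ (d v - a) (d v - b) ≥ 0`. -/
lemma degSqSum_ge (a b : ℤ) (h : ∀ x : ℤ, 0 ≤ (x - a) * (x - b)) :
    (a + b) * G.degSum - Fintype.card V * (a * b) ≤ G.degSqSum := by
  have := Finset.sum_nonneg fun v (_ : v ∈ Finset.univ) => h (G.degree v)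
  have e (x : ℤ) : (x - a) * (x - b) = x ^ 2 - (a + b) * x + a * b := by ring
  simp_rw [e, Finset.sum_add_distrib, Finset.sum_sub_distrib, ← Finset.mul_sum] at this
  simp only [Finset.sum_const, Finset.card_univ, nsmul_eq_mul] at this
  simp only [degSum, degSqSum]
  linarith

lemma sub_mul_sub_nonneg {a b : ℤ} (h : b = a ∨ b = a + 1) (x : ℤ) : 0 ≤ (x - a) * (x - b) := by
  rcases h with rfl | rfl
  · exact mul_self_nonneg _
  · rcases le_or_gt x a with h | h <;> nlinarith

/-- Sum $d(c)+d(d)\le n$ over ordered edges. -/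
lemma two_mul_degSqSum_le (hG : G.CliqueFree 3) :
    2 * G.degSqSum ≤ Fintype.card V * G.degSum := by
  have key (c d : V) : 0 ≤ G.adjInd c d * (Fintype.card V) -
        G.adjInd c d * G.degree c - G.adjInd c d * G.degree d := by
    by_cases h : G.Adj c d
    · simpa [adjInd, h] using hG.degree_add_degree_le h
    · simp [adjInd, h]
  have := Finset.sum_nonneg fun c (_ : c ∈ Finset.univ) =>
    Finset.sum_nonneg fun d (_ : d ∈ Finset.univ) => key c d
  rw [sum_sum_adjInd_mul_card_sub] at this
  linarith

lemma exists_degSum_eq (G : SimpleGraph V) [DecidableRel G.Adj] :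
    ∃ e : ℤ, 0 ≤ e ∧ G.degSum = 2 * e := by
  refine ⟨G.edgeFinset.card, by positivity, ?_⟩
  rw [degSum]
  exact_mod_cast G.sum_degrees_eq_twice_card_edges

end SimpleGraph

/-- The optimization over the number `e` of edges and the sum `D` of squared degrees. -/
lemma triangleFree_degree_optimization {n a b e D : ℤ} (hn : 5 ≤ n) (hab : b = a ∨ b = a + 1)
    (hsum : a + b = n) (he : 0 ≤ e) (h0 : 2 * e ≤ D) (h1 : 6 * e - 2 * n ≤ D)
    (h2 : n * (2 * e) - n * (a * b) ≤ D) (h3 : D ≤ n * e) :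
    10 * (n - 4) * (e ^ 2 + e - D) + (n - 3) ^ 2 * (n * e - D) ≤
      10 * (n - 4) * ((a * b) ^ 2 + a * b - n * (a * b)) := by
  -- Mantel's bound, from comparing `h2` with `h3`.
  have het : e ≤ a * b := by
    by_contra! h
    nlinarith
  rcases le_or_gt 12 n with hn12 | hn12
  · have ht : n ^ 2 - 1 ≤ 4 * (a * b) := by
      rcases hab with rfl | rfl <;> subst hsum <;> nlinarith
    generalize a * b = t at *
    have hA : 0 ≤ (10 * (n - 4) + (n - 3) ^ 2) := by nlinarith
    -- With `D` replaced by its lower bound `h2`, the right side minus the left is $t-e$ times the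
    -- gap in this inequality. It holds for all $e\ge0$ when $n\ge12$, but fails for $n=11$, $e=0$.
    have key : n * (n - 3) ^ 2 ≤ 10 * (n - 4) * (t + e + 1 - 2 * n) := by
      have : 0 ≤ (n - 4) * (4 * t + 4 * e - (n ^ 2 - 1)) := by
        apply mul_nonneg <;> linarith
      obtain ⟨k, rfl⟩ : ∃ k, n = k + 12 := ⟨n - 12, by ring⟩
      have hk : 0 ≤ k := by linarith
      nlinarith [pow_nonneg hk 2, pow_nonneg hk 3]
    have := mul_le_mul_of_nonneg_left h2 hA
    have := mul_le_mul_of_nonneg_left key (sub_nonneg.2 het)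
    nlinarith
  -- Finitely many pairs `n`, `e` remain, each linear in `D`; `h0` and `h1` are the useful bounds
  -- for sparse graphs.
  · have ha : a = n / 2 := by omega
    have hb : b = n - n / 2 := by omega
    subst ha hb
    interval_cases n <;> norm_num at * <;> interval_cases e <;> omega

/-! ### The upper bound and its attainment by $T_2(n)$. -/

namespace SimpleGraph

section

variable {V : Type*} [Fintype V] {G : SimpleGraph V}

lemma copyCount_graphM'_le (hG : G.CliqueFree 3) : G.copyCount graphM' ≤ G.copyCount graphM := by
  classical
  have := labelledCopyCount_graphM'_le hG
  rw [labelledCopyCount_graphM_eq_mul, labelledCopyCount_graphM'_eq_mul] at this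
  omega

lemma copyCount_graphM'_eq (hG : ∀ u v w, G.Adj u v → (G.Adj w u ↔ ¬ G.Adj w v)) :
    G.copyCount graphM' = G.copyCount graphM := by
  classical
  have := labelledCopyCount_graphM'_eq hG
  rw [labelledCopyCount_graphM_eq_mul, labelledCopyCount_graphM'_eq_mul] at this
  omega

lemma copyCount_eq_zero_of_card_lt {H : SimpleGraph (Fin 5)} (h : Fintype.card V < 5) :
    G.copyCount H = 0 := by
  rw [copyCount_eq_zero]
  rintro ⟨f⟩
  have := Fintype.card_le_of_embedding f.toEmbedding
  rw [Fintype.card_fin] at this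
  omega

/-- The bound on the number of copies of `graphM` and of the five-cycle, with `a` and `b` the
sizes of the parts of the balanced complete bipartite graph. -/
lemma copyCount_graphM_add_cycleGraph_le (hG : G.CliqueFree 3) (hn : 5 ≤ Fintype.card V) {a b : ℤ}
    (hab : b = a ∨ b = a + 1) (hsum : a + b = Fintype.card V) :
    2 * ((G.copyCount graphM : ℤ) + G.copyCount (cycleGraph 5)) ≤
      ((Fintype.card V : ℤ) - 4) * ((a * b) ^ 2 + a * b - Fintype.card V * (a * b)) := by
  classical
  obtain ⟨e, he, hm⟩ := exists_degSum_eq G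
  have hM := G.labelledCopyCount_graphM_eq
  have hC := labelledCopyCount_cycleGraph_five_le hG
  -- No integer lies strictly between consecutive integers; the pairs are chosen for average degree
  -- near 0 to 1, near 1 to 2, and near $n/2$.
  have h0 := G.degSqSum_ge 0 1 (sub_mul_sub_nonneg (by simp))
  have h1 := G.degSqSum_ge 1 2 (sub_mul_sub_nonneg (by simp))
  have h2 := G.degSqSum_ge a b (sub_mul_sub_nonneg hab)
  have h3 := two_mul_degSqSum_le hG
  rw [labelledCopyCount_graphM_eq_mul] at hM
  rw [labelledCopyCount_cycleGraph_five_eq_mul] at hC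
  rw [hm] at *
  rw [hsum] at h2
  push_cast at *
  have hn' : (5 : ℤ) ≤ Fintype.card V := by exact_mod_cast hn
  have := triangleFree_degree_optimization hn' hab hsum he (D := G.degSqSum) (by linarith)
    (by linarith) h2 (by linarith)
  linarith

/-- The balanced complete bipartite graph has as many copies of `graphM` as the bound allows. -/
lemma copyCount_graphM_of_complete_bipartite {a b : ℤ} (hsum : a + b = Fintype.card V)
    (h0 : 0 < Fintype.card V) [DecidableRel G.Adj]
    (hdeg : ∀ v, (G.degree v : ℤ) = a ∨ (G.degree v : ℤ) = b)
    (hadj : ∀ u v w, G.Adj u v → (G.Adj w u ↔ ¬ G.Adj w v)) :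
    2 * (G.copyCount graphM : ℤ) =
      ((Fintype.card V : ℤ) - 4) * ((a * b) ^ 2 + a * b - Fintype.card V * (a * b)) := by
  classical
  have hD : 2 * G.degSqSum = Fintype.card V * G.degSum := by
    have key (c d : V) : G.adjInd c d * (Fintype.card V) -
        G.adjInd c d * G.degree c - G.adjInd c d * G.degree d = 0 := by
      by_cases h : G.Adj c d
      · have hv (v : V) : 1 - G.adjInd c v - G.adjInd d v = 0 := by
          have := hadj c d v h
          rw [G.adj_comm v c, G.adj_comm v d] at this
          unfold adjInd
          by_cases h2 : G.Adj d v <;> simp [this, h2]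
        have := Finset.sum_eq_zero fun v (_ : v ∈ Finset.univ) => hv v
        simp only [Finset.sum_sub_distrib, sum_adjInd] at this
        simpa [adjInd, h] using this
      · simp [adjInd, h]
    have := Finset.sum_eq_zero fun c (_ : c ∈ Finset.univ) =>
      Finset.sum_eq_zero fun d (_ : d ∈ Finset.univ) => key c d
    rw [sum_sum_adjInd_mul_card_sub] at this
    linarith
  have hD2 : G.degSqSum = (a + b) * G.degSum - Fintype.card V * (a * b) := by
    have e (v : V) : (G.degree v : ℤ) ^ 2 = (a + b) * G.degree v - a * b := by
      rcases hdeg v with h | h <;> rw [h] <;> ring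
    simp only [degSum, degSqSum, e, Finset.sum_sub_distrib, ← Finset.mul_sum]
    simp only [Finset.sum_const, Finset.card_univ, nsmul_eq_mul]
    ring
  rw [hsum] at hD2
  -- The two evaluations of `degSqSum` determine the edge count.
  have hm : G.degSum = 2 * (a * b) := by
    have h0' : (Fintype.card V : ℤ) ≠ 0 := by exact_mod_cast h0.ne'
    apply mul_left_cancel₀ h0'
    linarith
  have hM := G.labelledCopyCount_graphM_eq
  rw [labelledCopyCount_graphM_eq_mul, hD2, hm] at hM
  push_cast at hM
  linarith

end

lemma turanGraph_two_adj_iff {n : ℕ} (u v w : Fin n) (h : (turanGraph n 2).Adj u v) :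
    (turanGraph n 2).Adj w u ↔ ¬ (turanGraph n 2).Adj w v := by
  simp only [turanGraph_adj] at *
  omega

lemma card_filter_fin_mod_two (n : ℕ) :
    (Finset.univ.filter fun w : Fin n => (w : ℕ) % 2 = 0).card = n - n / 2 ∧
    (Finset.univ.filter fun w : Fin n => (w : ℕ) % 2 = 1).card = n / 2 := by
  induction n with
  | zero => simp
  | succ n ih =>
    simp only [Finset.card_filter, Fin.sum_univ_castSucc, Fin.val_castSucc, Fin.val_last] at ih ⊢
    split_ifs <;> omega

lemma degree_turanGraph_two {n : ℕ} (v : Fin n) : (turanGraph n 2).degree v = n / 2 ∨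
    (turanGraph n 2).degree v = n - n / 2 := by
  rw [← card_neighborFinset_eq_degree, neighborFinset_eq_filter]
  simp only [turanGraph_adj]
  rcases Nat.mod_two_eq_zero_or_one (v : ℕ) with h | h
  · left
    rw [← (card_filter_fin_mod_two n).2]
    congr 1
    ext w
    simp only [Finset.mem_filter, Finset.mem_univ, true_and]
    omega
  · right
    rw [← (card_filter_fin_mod_two n).1]
    congr 1
    ext w
    simp only [Finset.mem_filter, Finset.mem_univ, true_and]
    omega

lemma copyCount_graphM_add_cycleGraph_le_turanGraph {n : ℕ} {G : SimpleGraph (Fin n)}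
    (hG : G.CliqueFree 3) : G.copyCount graphM + G.copyCount (cycleGraph 5) ≤
      (turanGraph n 2).copyCount graphM := by
  rcases lt_or_ge n 5 with hn | hn
  · simp [copyCount_eq_zero_of_card_lt (V := Fin n) (by simpa using hn)]
  have hsum : ((n / 2 : ℕ) : ℤ) + ((n - n / 2 : ℕ) : ℤ) = Fintype.card (Fin n) := by
    rw [Fintype.card_fin]; omega
  have h1 := copyCount_graphM_add_cycleGraph_le hG (by simpa using hn) (by omega) hsum
  have h2 := copyCount_graphM_of_complete_bipartite (G := turanGraph n 2) hsum
    (by rw [Fintype.card_fin]; omega)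
    (fun v => by exact_mod_cast degree_turanGraph_two v) turanGraph_two_adj_iff
  omega

end SimpleGraph

lemma pairEx_eq_of_forall_le {W₁ W₂ W : Type*} {n : ℕ} {H₁ : SimpleGraph W₁}
    {H₂ : SimpleGraph W₂} {F : SimpleGraph W} {T : SimpleGraph (Fin n)} (hT : F.Free T)
    (h : ∀ G : SimpleGraph (Fin n), F.Free G → pairCount H₁ H₂ G ≤ pairCount H₁ H₂ T) :
    pairEx n H₁ H₂ F = pairCount H₁ H₂ T := by
  classical
  refine le_antisymm (Finset.sup_le fun G hG => h G (Finset.mem_filter.1 hG).2) ?_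
  exact Finset.le_sup (f := pairCount H₁ H₂) (Finset.mem_filter.2 ⟨Finset.mem_univ _, hT⟩)

theorem mainTheorem9 (n : ℕ) :
    (SimpleGraph.completeGraph (Fin 3)).Free (SimpleGraph.turanGraph n 2) ∧
    pairEx n graphM (SimpleGraph.cycleGraph 5) (SimpleGraph.completeGraph (Fin 3)) =
      pairCount graphM (SimpleGraph.cycleGraph 5) (SimpleGraph.turanGraph n 2) ∧
    pairEx n graphM' (SimpleGraph.cycleGraph 5) (SimpleGraph.completeGraph (Fin 3)) =
      pairCount graphM' (SimpleGraph.cycleGraph 5) (SimpleGraph.turanGraph n 2) := by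
  have hfree : (SimpleGraph.completeGraph (Fin 3)).Free (SimpleGraph.turanGraph n 2) :=
    SimpleGraph.cliqueFree_iff_top_free.1 (by simpa using SimpleGraph.turanGraph_cliqueFree two_pos)
  have hle (G : SimpleGraph (Fin n)) (hG : (SimpleGraph.completeGraph (Fin 3)).Free G) :
      G.CliqueFree 3 := by simpa using SimpleGraph.cliqueFree_iff_top_free.2 hG
  refine ⟨hfree, pairEx_eq_of_forall_le hfree fun G hG => ?_,
    pairEx_eq_of_forall_le hfree fun G hG => ?_⟩
  · have := SimpleGraph.copyCount_graphM_add_cycleGraph_le_turanGraph (hle G hG)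
    unfold pairCount
    omega
  · have h1 := SimpleGraph.copyCount_graphM_add_cycleGraph_le_turanGraph (hle G hG)
    have h2 := SimpleGraph.copyCount_graphM'_le (hle G hG)
    have h3 := SimpleGraph.copyCount_graphM'_eq (SimpleGraph.turanGraph_two_adj_iff (n := n))
    unfold pairCount
    omega
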